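/- Let $(M,d)$ be a complete metric space and $1\le p<\infty$. Let $\mathcal P(M)$ be the set of Borel probability measures $\mu$ on $M$ with $\mu(\operatorname{supp}\mu)=1$, and let $\mathcal P^p(M)$ be the set of $\mu\in\mathcal P(M)$ with $\int_M d(x,y)^p\,d\mu(y)<\infty$ for some $x\in M$. For $\mu,\nu\in\mathcal P^p(M)$ let $d_p^W(\mu,\nu)=\bigl[\inf_{\pi}\int_{M\times M}d(x,y)^p\,d\pi(x,y)\bigr]^{1/p}$ be the $p$-Wasserstein distance, the infimum being over all $\pi\in\mathcal P(M\times M)$ with marginals $\mu$ and $\nu$. Let $\beta:\mathcal P^p(M)\to M$ be a $p$-contractive barycentric map, i.e. $\beta(\delta_x)=x$ for all $x\in M$ and $d(\beta(\mu),\beta(\nu))\le d_p^W(\mu,\nu)$ for all $\mu,\nu\in\mathcal P^p(M)$. Let $(\Omega,\mathcal A,\mathbf P)$ be a probability space with $(\Omega,\mathcal A)$ standard Borel, and let $T:\Omega\to\Omega$ be a measurable map preserving $\mathbf P$. Let $L^p(\Omega;M)$ be the set of Borel measurable $\varphi:\Omega\to M$ that are a.e. limits of simple functions and satisfy $\int_\Omega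 d(x,\varphi(\omega))^p\,d\mathbf P(\omega)<\infty$ for some $x\in M$, with a.e. equal functions identified, and put $\mathbf d_p(\varphi,\psi)=\bigl[\int_\Omega d(\varphi,\psi)^p\,d\mathbf P\bigr]^{1/p}$. For $\varphi\in L^p(\Omega;M)$ and $n\ge1$ let $\mu_n^\varphi(\omega)=\frac1n\sum_{k=0}^{n-1}\delta_{\varphi(T^k\omega)}$. An ergodic limit map is a map $\Gamma$ from $L^p(\Omega;M)$ onto $\{\varphi\in L^p(\Omega;M):\varphi\circ T=\varphi\}$ such that, for all $\varphi,\psi\in L^p(\Omega;M)$: (i) $d(\beta(\mu_n^\varphi(\omega)),\Gamma(\varphi)(\omega))\to0$ for a.e. $\omega$; (ii) $\mathbf d_p(\beta(\mu_n^\varphi),\Gamma(\varphi))\to0$; (iii) $\mathbf d_p(\Gamma(\varphi),\Gamma(\psi))\le\mathbf d_p(\varphi,\psi)$. Let $\mathcal I=\{A\in\mathcal A:T^{-1}A=A\}$. A disintegration of $\mathbf P$ with respect to $\mathcal I$ is a family $(\mathbf P_\omega)_{\omega\in\Omega}$ of probability measures on $(\Omega,\mathcal A)$ such that, for every $A\in\mathcal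 A$, the function $\omega\mapsto\mathbf P_\omega(A)$ is $\mathcal I$-measurable and is a conditional expectation of $\mathbf 1_A$ with respect to $\mathcal I$. Then an ergodic limit map $\Gamma$ exists, and a disintegration of $\mathbf P$ with respect to $\mathcal I$ exists. Moreover, for every ergodic limit map $\Gamma$, every disintegration $(\mathbf P_\omega)_{\omega\in\Omega}$ of $\mathbf P$ with respect to $\mathcal I$ and every $\varphi\in L^p(\Omega;M)$, one has $\varphi_*\mathbf P_\omega\in\mathcal P^p(M)$ for $\mathbf P$-a.e. $\omega$, and $\Gamma(\varphi)$ is the $\beta$-conditional expectation of $\varphi$ with respect to $\mathcal I$: $$\Gamma(\varphi)(\omega)=E^\beta_{\mathcal I}(\varphi)(\omega):=\beta(\varphi_*\mathbf P_\omega)\qquad\text{for }\mathbf P\text{-a.e. }\omega\in\Omega .$$ -/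

import Mathlib

open MeasureTheory Filter Topology
open scoped ENNReal

noncomputable section

namespace Barycentric

/-- The set `P^p(M)`: Borel probability measures of full support mass (that is, `μ (supp μ) = 1`)
with `∫ d(x, y)^p dμ(y) < ∞` for some `x`. -/
def Pp (M : Type*) [MetricSpace M] [MeasurableSpace M] (p : ℝ) : Set (Measure M) :=
  {μ | IsProbabilityMeasure μ ∧ μ μ.support = 1 ∧ ∃ x : M, ∫⁻ y, edist x y ^ p ∂μ < ∞}

/-- The couplings `Π(μ, ν)`: probability measures on the Borel sets of `M × M`, with
`π (supp π) = 1`, whose marginals are `μ` and `ν`. (When `M` is not separable, the Borel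
`σ`-algebra of `M × M` may be larger than the product `σ`-algebra, hence the explicit `borel`.) -/
def couplings {M : Type*} [MetricSpace M] [MeasurableSpace M] (μ ν : Measure M) :
    Set (@Measure (M × M) (borel (M × M))) :=
  letI : MeasurableSpace (M × M) := borel (M × M)
  {π | IsProbabilityMeasure π ∧ π π.support = 1 ∧
    ∀ B : Set M, MeasurableSet B → π (B ×ˢ Set.univ) = μ B ∧ π (Set.univ ×ˢ B) = ν B}

/-- The `p`-Wasserstein distance `d_p^W`, with values in `[0, ∞]`. -/
def wasserstein {M : Type*} [MetricSpace M] [MeasurableSpace M] (p : ℝ) (μ ν : Measure M) :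
    ℝ≥0∞ :=
  letI : MeasurableSpace (M × M) := borel (M × M)
  (⨅ π ∈ couplings μ ν, ∫⁻ z, edist z.1 z.2 ^ p ∂π) ^ (1 / p)

theorem mem_support_of_singleton {M : Type*} [MetricSpace M] [MeasurableSpace M]
    {μ : Measure M} {x : M} (h : 0 < μ {x}) : x ∈ μ.support := by
  rw [Measure.mem_support_iff_forall]
  intro U hU
  exact h.trans_le (measure_mono (Set.singleton_subset_iff.2 (mem_of_mem_nhds hU)))

theorem dirac_mem_Pp {M : Type*} [MetricSpace M] [MeasurableSpace M] [BorelSpace M]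
    {p : ℝ} (hp : 1 ≤ p) (x : M) : Measure.dirac x ∈ Pp M p := by
  refine ⟨inferInstance, ?_, x, ?_⟩
  · rw [Measure.dirac_apply_of_mem]
    exact mem_support_of_singleton (by simp)
  · rw [lintegral_dirac]
    simp [ENNReal.zero_rpow_of_pos (zero_lt_one.trans_le hp)]

/-- The empirical measure `μ_n^φ(ω) = (1/n) ∑_{k < n} δ_{φ (T^k ω)}`. -/
def empiricalMeasure {Ω M : Type*} [MeasurableSpace M] (T : Ω → Ω) (φ : Ω → M) (n : ℕ) (ω : Ω) :
    Measure M :=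
  (n : ℝ≥0∞)⁻¹ • ∑ k ∈ Finset.range n, Measure.dirac (φ (T^[k] ω))

theorem empiricalMeasure_mem_Pp {Ω M : Type*} [MetricSpace M] [MeasurableSpace M] [BorelSpace M]
    {p : ℝ} (hp : 1 ≤ p) (T : Ω → Ω) (φ : Ω → M) (n : ℕ) (ω : Ω) :
    empiricalMeasure T φ (n + 1) ω ∈ Pp M p := by
  have hp0 : 0 < p := zero_lt_one.trans_le hp
  have hn0 : ((n + 1 : ℕ) : ℝ≥0∞) ≠ 0 := by simp
  have hnt : ((n + 1 : ℕ) : ℝ≥0∞) ≠ ∞ := ENNReal.natCast_ne_top _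
  have hprob : IsProbabilityMeasure (empiricalMeasure T φ (n + 1) ω) := by
    constructor
    simp only [empiricalMeasure, Measure.smul_apply, Measure.finsetSum_apply, measure_univ,
      Finset.sum_const, Finset.card_range, smul_eq_mul, nsmul_eq_mul, mul_one]
    exact ENNReal.inv_mul_cancel hn0 hnt
  refine ⟨hprob, ?_, φ ω, ?_⟩
  · have hmem : ∀ k ∈ Finset.range (n + 1),
        φ (T^[k] ω) ∈ (empiricalMeasure T φ (n + 1) ω).support := by
      intro k hk
      apply mem_support_of_singleton
      simp only [empiricalMeasure, Measure.smul_apply, Measure.finsetSum_apply, smul_eq_mul]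
      refine ENNReal.mul_pos (ENNReal.inv_ne_zero.2 hnt) (ne_of_gt ?_)
      refine lt_of_lt_of_le ?_ (Finset.single_le_sum (fun _ _ => zero_le) hk)
      simp
    refine le_antisymm prob_le_one ?_
    set S := (empiricalMeasure T φ (n + 1) ω).support with hS
    rw [empiricalMeasure, Measure.smul_apply, Measure.finsetSum_apply,
      Finset.sum_congr rfl (fun k hk => Measure.dirac_apply_of_mem (hmem k hk))]
    simp only [Finset.sum_const, Finset.card_range, smul_eq_mul, nsmul_eq_mul, mul_one]
    rw [ENNReal.inv_mul_cancel hn0 hnt]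
  · rw [empiricalMeasure, lintegral_smul_measure, lintegral_finsetSum_measure]
    simp only [lintegral_dirac, smul_eq_mul]
    refine ENNReal.mul_lt_top (ENNReal.inv_lt_top.2 (pos_iff_ne_zero.2 hn0)) ?_
    exact ENNReal.sum_lt_top.2 fun k _ =>
      ENNReal.rpow_lt_top_of_nonneg hp0.le (edist_ne_top _ _)

/-- `β : P^p(M) → M` is a `p`-contractive barycentric map. -/
structure IsContractiveBarycentric {M : Type*} [MetricSpace M] [MeasurableSpace M] [BorelSpace M]
    {p : ℝ} (hp : 1 ≤ p) (β : Pp M p → M) : Prop where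
  apply_dirac : ∀ x : M, β ⟨Measure.dirac x, dirac_mem_Pp hp x⟩ = x
  contractive : ∀ μ ν : Pp M p, edist (β μ) (β ν) ≤ wasserstein p μ.1 ν.1

/-- The `p`-th Bochner integrable functions `L^p(Ω; M)`: Borel measurable and strongly measurable
(almost everywhere limits of simple functions), with `∫ d(x, φ)^p dP < ∞` for some `x`. They are
kept as functions; statements below identify them up to almost everywhere equality. -/
def BochnerLp {Ω : Type*} [MeasurableSpace Ω] (M : Type*) [MetricSpace M] [MeasurableSpace M]
    (p : ℝ) (P : Measure Ω) : Set (Ω → M) :=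
  {φ | Measurable φ ∧ AEStronglyMeasurable φ P ∧ ∃ x : M, ∫⁻ ω, edist x (φ ω) ^ p ∂P < ∞}

/-- The `L^p`-distance of two `M`-valued functions, with values in `[0, ∞]`. -/
def distLp {Ω M : Type*} [MeasurableSpace Ω] [MetricSpace M] (p : ℝ) (P : Measure Ω)
    (φ ψ : Ω → M) : ℝ≥0∞ :=
  (∫⁻ ω, edist (φ ω) (ψ ω) ^ p ∂P) ^ (1 / p)

/-- The function `ω ↦ β (μ_{n+1}^φ(ω))`. The index is shifted so that the sequence
`β (μ_1^φ), β (μ_2^φ), …` starts at `n = 0`. -/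
def baryEmpirical {Ω M : Type*} [MetricSpace M] [MeasurableSpace M] [BorelSpace M]
    {p : ℝ} (hp : 1 ≤ p) (β : Pp M p → M) (T : Ω → Ω) (φ : Ω → M) (n : ℕ) (ω : Ω) : M :=
  β ⟨empiricalMeasure T φ (n + 1) ω, empiricalMeasure_mem_Pp hp T φ n ω⟩

/-- `Γ` is the ergodic limit map: it sends `L^p(Ω; M)` onto the `T`-invariant functions in
`L^p(Ω; M)` (up to almost everywhere equality), `β (μ_n^φ) → Γ φ` almost everywhere and in the
`L^p`-distance, and `Γ` does not increase the `L^p`-distance. -/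
structure IsErgodicLimitMap {Ω M : Type*} [MeasurableSpace Ω] [MetricSpace M] [MeasurableSpace M]
    [BorelSpace M] {p : ℝ} (hp : 1 ≤ p) (β : Pp M p → M) (T : Ω → Ω) (P : Measure Ω)
    (Γ : BochnerLp M p P → BochnerLp M p P) : Prop where
  invariant : ∀ φ, (Γ φ).1 ∘ T =ᵐ[P] (Γ φ).1
  onto : ∀ ψ : BochnerLp M p P, ψ.1 ∘ T =ᵐ[P] ψ.1 → ∃ φ, (Γ φ).1 =ᵐ[P] ψ.1
  tendsto_ae : ∀ φ, ∀ᵐ ω ∂P,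
    Tendsto (fun n => baryEmpirical hp β T φ.1 n ω) atTop (𝓝 ((Γ φ).1 ω))
  tendsto_Lp : ∀ φ,
    Tendsto (fun n => distLp p P (baryEmpirical hp β T φ.1 n) (Γ φ).1) atTop (𝓝 0)
  contractive : ∀ φ ψ, distLp p P (Γ φ).1 (Γ ψ).1 ≤ distLp p P φ.1 ψ.1

/-- `(κ ω)_ω` is a disintegration of `P` with respect to the sub-`σ`-algebra `m`: a family of
probability measures such that, for every measurable `A`, the function `ω ↦ κ ω A` is
`m`-measurable and is a conditional expectation of the indicator of `A` with respect to `m`. -/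
structure IsDisintegration {Ω : Type*} (m : MeasurableSpace Ω) [mΩ : MeasurableSpace Ω]
    (P : Measure Ω) (κ : Ω → Measure Ω) : Prop where
  isProbabilityMeasure : ∀ ω, IsProbabilityMeasure (κ ω)
  measurable : ∀ A, MeasurableSet[mΩ] A → Measurable[m] (fun ω => κ ω A)
  ae_eq_condExp : ∀ A, MeasurableSet[mΩ] A →
    (fun ω => (κ ω A).toReal) =ᵐ[P] P[A.indicator (fun _ => (1 : ℝ)) | m]

open Classical in
/-- The `β`-conditional expectation `ω ↦ β (φ_* κ_ω)` with respect to the `σ`-algebra along which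
`κ` is a disintegration. On the (null) set of `ω` where `φ_* κ_ω` is not in `P^p(M)` the value is
irrelevant, and is set to `φ ω`. -/
def betaCondExp {Ω M : Type*} [MeasurableSpace Ω] [MetricSpace M] [MeasurableSpace M]
    {p : ℝ} (β : Pp M p → M) (κ : Ω → Measure Ω) (φ : Ω → M) (ω : Ω) : M :=
  if h : (κ ω).map φ ∈ Pp M p then β ⟨(κ ω).map φ, h⟩ else φ ω

end Barycentric

end

/-!
The empirical measures `μ_n^φ(ω)` and the measures `φ_* P_ω` are the images under `φ` of two kinds
of Markov kernels on `Ω`: the orbit averages and the disintegration. Both leave `P` invariant, so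
`p`-contractivity of `β`, applied to the couplings `(φ, ψ)_* η_ω` and integrated, shows that
`φ ↦ β (φ_* η)` is a contraction of `L^p(Ω; M)` for each of these kernels `η`. For a simple function
the image measure is determined by finitely many weights; these converge by Birkhoff's theorem, and
`β` depends continuously on them, because nearby weight vectors have a common part of mass close to
one, which a coupling can leave in place. Approximation by simple functions extends the convergence
to all of `L^p(Ω; M)`, pointwise by applying Birkhoff's theorem to `d(φ, ψ)^p`. Thus
`β (φ_* P_ω)` is the ergodic limit, and it is unique because limits are.
-/

noncomputable section

open ProbabilityTheory
open scoped NNReal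

namespace Barycentric

section Birkhoff

/-- The maximal function `max_{k ≤ n} S_k g` of the Birkhoff sums `S_k g`, including the empty sum
`S_0 g = 0`. -/
def birkhoffMax {Ω : Type*} (T : Ω → Ω) (g : Ω → ℝ) (n : ℕ) (ω : Ω) : ℝ :=
  partialSups (fun k => birkhoffSum T g k ω) n

variable {Ω : Type*} {T : Ω → Ω} {g : Ω → ℝ}

theorem birkhoffMax_mono (ω : Ω) : Monotone fun n => birkhoffMax T g n ω :=
  (partialSups fun k => birkhoffSum T g k ω).monotone

theorem birkhoffMax_nonneg (n : ℕ) (ω : Ω) : 0 ≤ birkhoffMax T g n ω := by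
  simpa [birkhoffMax] using birkhoffMax_mono (T := T) (g := g) ω n.zero_le

theorem birkhoffMax_succ (n : ℕ) (ω : Ω) :
    birkhoffMax T g (n + 1) ω = max 0 (g ω + birkhoffMax T g n (T ω)) := by
  have hsucc (m : ℕ) (ω' : Ω) : birkhoffMax T g (m + 1) ω'
      = max (birkhoffMax T g m ω') (birkhoffSum T g (m + 1) ω') :=
    partialSups_add_one _ m
  induction n with
  | zero => rw [hsucc]; simp [birkhoffMax]
  | succ n ih =>
    rw [hsucc (n + 1) ω, ih, hsucc n (T ω), birkhoffSum_succ', max_assoc, ← max_add_add_left]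

/-- The set where the Birkhoff sums of `g` are unbounded above. -/
def birkhoffUnbounded (T : Ω → Ω) (g : Ω → ℝ) : Set Ω :=
  {ω | ¬ BddAbove (Set.range fun n => birkhoffSum T g n ω)}

theorem preimage_birkhoffUnbounded : T ⁻¹' birkhoffUnbounded T g = birkhoffUnbounded T g := by
  ext ω
  simp only [birkhoffUnbounded, Set.mem_preimage, Set.mem_ofPred_eq, not_iff_not]
  constructor
  · rintro ⟨C, hC⟩
    refine ⟨max 0 (g ω + C), ?_⟩
    rintro _ ⟨_ | n, rfl⟩
    · simp
    · have hn := hC ⟨n, rfl⟩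
      simp only [birkhoffSum_succ'] at hn ⊢
      exact le_max_of_le_right (by gcongr)
  · rintro ⟨C, hC⟩
    refine ⟨C - g ω, ?_⟩
    rintro _ ⟨n, rfl⟩
    have hn := hC ⟨n + 1, rfl⟩
    simp only [birkhoffSum_succ'] at hn ⊢
    linarith

theorem tendsto_birkhoffMax_atTop {ω : Ω} (hω : ω ∈ birkhoffUnbounded T g) :
    Tendsto (fun n => birkhoffMax T g n ω) atTop atTop :=
  tendsto_atTop_atTop_of_monotone' (birkhoffMax_mono ω) fun h =>
    hω (bddAbove_range_partialSups.1 h)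

theorem eventually_birkhoffAverage_lt {ω : Ω} (hω : ω ∉ birkhoffUnbounded T g) {ε : ℝ}
    (hε : 0 < ε) : ∀ᶠ n in atTop, birkhoffAverage ℝ T g n ω < ε := by
  obtain ⟨C, hC⟩ := not_not.1 hω
  have hlim : Tendsto (fun n : ℕ => C / n) atTop (𝓝 0) := tendsto_const_div_atTop_nhds_zero_nat C
  filter_upwards [hlim.eventually_lt_const hε] with n hn
  refine lt_of_le_of_lt ?_ hn
  rw [birkhoffAverage, smul_eq_mul, div_eq_inv_mul]
  gcongr
  exact hC ⟨n, rfl⟩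

variable [MeasurableSpace Ω] {P : Measure Ω}

theorem measurable_birkhoffSum (hT : Measurable T) (hg : Measurable g) (n : ℕ) :
    Measurable (birkhoffSum T g n) :=
  Finset.measurable_fun_sum _ fun k _ => hg.comp (hT.iterate k)

theorem measurableSet_birkhoffUnbounded (hT : Measurable T) (hg : Measurable g) :
    MeasurableSet[MeasurableSpace.invariants T] (birkhoffUnbounded T g) :=
  MeasurableSpace.measurableSet_invariants.2
    ⟨(measurableSet_bddAbove_range (measurable_birkhoffSum hT hg)).compl,
      preimage_birkhoffUnbounded⟩

theorem integrable_birkhoffMax (hT : MeasurePreserving T P P) (hg : Integrable g P) (n : ℕ) :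
    Integrable (birkhoffMax T g n) P := by
  induction n with
  | zero =>
    refine (integrable_zero Ω ℝ P).congr (.of_forall fun ω => ?_)
    simp [birkhoffMax]
  | succ n ih =>
    simp only [funext (birkhoffMax_succ n), max_comm (0 : ℝ)]
    exact (hg.add (hT.integrable_comp_of_integrable ih)).pos_part

theorem setIntegral_comp_of_preimage_eq {E : Type*} [NormedAddCommGroup E] [NormedSpace ℝ E]
    (hT : MeasurePreserving T P P) {A : Set Ω} (hA : MeasurableSet A) (hTA : T ⁻¹' A = A)
    {f : Ω → E} (hf : AEStronglyMeasurable f P) :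
    ∫ ω in A, f (T ω) ∂P = ∫ ω in A, f ω ∂P := by
  have hTP : MeasurePreserving T (P.restrict A) (P.restrict A) := by
    simpa only [hTA] using hT.restrict_preimage hA
  conv_rhs => rw [← hTP.map_eq]
  exact (integral_map hTP.aemeasurable (by rw [hTP.map_eq]; exact hf.restrict)).symm

/-- Garsia's argument: `max_{k ≤ n + 1} S_k g - (max_{k ≤ n} S_k g) ∘ T` has a nonnegative
integral, and it converges to `g` on this set. -/
theorem setIntegral_birkhoffUnbounded_nonneg (hT : MeasurePreserving T P P) (hgm : Measurable g)
    (hg : Integrable g P) : 0 ≤ ∫ ω in birkhoffUnbounded T g, g ω ∂P := by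
  set A := birkhoffUnbounded T g
  obtain ⟨hAm, hAT⟩ := measurableSet_birkhoffUnbounded hT.measurable hgm
  have hint := integrable_birkhoffMax hT hg
  have hintT (n : ℕ) : Integrable (fun ω => birkhoffMax T g n (T ω)) P :=
    hT.integrable_comp_of_integrable (hint n)
  have hnonneg (n : ℕ) :
      0 ≤ ∫ ω in A, (birkhoffMax T g (n + 1) ω - birkhoffMax T g n (T ω)) ∂P := by
    rw [integral_sub (hint _).restrict (hintT n).restrict,
      setIntegral_comp_of_preimage_eq hT hAm hAT (hint n).aestronglyMeasurable, sub_nonneg]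
    exact setIntegral_mono (hint _).integrableOn (hint _).integrableOn
      fun ω => birkhoffMax_mono ω n.le_succ
  have hdiff (n : ℕ) (ω : Ω) : birkhoffMax T g (n + 1) ω - birkhoffMax T g n (T ω)
      = max (-birkhoffMax T g n (T ω)) (g ω) := by
    rw [birkhoffMax_succ, ← max_sub_sub_right, zero_sub, add_sub_cancel_right]
  refine ge_of_tendsto' (tendsto_integral_of_dominated_convergence
    (F := fun n ω => birkhoffMax T g (n + 1) ω - birkhoffMax T g n (T ω)) (fun ω => |g ω|)
    (fun n => ((hint _).sub (hintT n)).aestronglyMeasurable.restrict) hg.abs.restrict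
    (fun n => .of_forall fun ω => ?_)
    ((ae_restrict_iff' hAm).2 (.of_forall fun ω hω => ?_))) hnonneg
  · rw [hdiff, Real.norm_eq_abs, abs_le]
    exact ⟨(neg_abs_le _).trans (le_max_right _ _),
      max_le ((neg_nonpos.2 (birkhoffMax_nonneg n _)).trans (abs_nonneg _)) (le_abs_self _)⟩
  · have hω' : T ω ∈ A := by rwa [← Set.mem_preimage, hAT]
    refine tendsto_const_nhds.congr' ?_
    filter_upwards [(tendsto_birkhoffMax_atTop hω').eventually_ge_atTop (-g ω)] with n hn
    rw [hdiff, max_eq_right (by linarith)]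

variable [IsFiniteMeasure P]

theorem ae_notMem_birkhoffUnbounded (hT : MeasurePreserving T P P) (hgm : Measurable g)
    (hg : Integrable g P) (hneg : ∀ᵐ ω ∂P, P[g | MeasurableSpace.invariants T] ω < 0) :
    ∀ᵐ ω ∂P, ω ∉ birkhoffUnbounded T g := by
  set A := birkhoffUnbounded T g
  have hA := measurableSet_birkhoffUnbounded hT.measurable hgm
  have hle := MeasurableSpace.invariants_le T
  have hcond : 0 ≤ ∫ ω in A, P[g | MeasurableSpace.invariants T] ω ∂P :=
    (setIntegral_birkhoffUnbounded_nonneg hT hgm hg).trans_eq (setIntegral_condExp hle hg hA).symm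
  by_contra hmem
  refine hcond.not_gt ?_
  rw [← neg_pos, ← integral_neg, integral_pos_iff_support_of_nonneg_ae
    (ae_restrict_of_ae (hneg.mono fun ω hω => neg_nonneg.2 hω.le)) integrable_condExp.neg.restrict,
    Measure.restrict_apply₀' (hle _ hA).nullMeasurableSet, pos_iff_ne_zero]
  intro hzero
  refine hmem ?_
  filter_upwards [measure_eq_zero_iff_ae_notMem.1 hzero, hneg] with ω hω hω' hωA
  exact hω ⟨(neg_pos.2 hω').ne', hωA⟩

theorem ae_eventually_birkhoffAverage_lt (hT : MeasurePreserving T P P) {f : Ω → ℝ}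
    (hfm : Measurable f) (hf : Integrable f P) :
    ∀ᵐ ω ∂P, ∀ ε > 0, ∀ᶠ n in atTop,
      birkhoffAverage ℝ T f n ω < P[f | MeasurableSpace.invariants T] ω + ε := by
  have hle := MeasurableSpace.invariants_le T
  have main (ε : ℝ) (hε : 0 < ε) : ∀ᵐ ω ∂P, ∀ᶠ n in atTop,
      birkhoffAverage ℝ T f n ω < P[f | MeasurableSpace.invariants T] ω + ε := by
    set h : Ω → ℝ := P[f | MeasurableSpace.invariants T] + fun _ => ε / 2
    have hhm : Measurable[MeasurableSpace.invariants T] h :=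
      stronglyMeasurable_condExp.measurable.add measurable_const
    have hh : Integrable h P := integrable_condExp.add (integrable_const _)
    have hcond : P[f - h | MeasurableSpace.invariants T] =ᵐ[P] fun _ => -(ε / 2) := by
      filter_upwards [condExp_sub hf hh _] with ω hω
      rw [hω, Pi.sub_apply, condExp_of_stronglyMeasurable hle hhm.stronglyMeasurable hh]
      simp [h]
    filter_upwards [ae_notMem_birkhoffUnbounded hT (hfm.sub (hhm.mono hle le_rfl)) (hf.sub hh)
      (hcond.mono fun ω hω => by rw [hω]; linarith)] with ω hω
    filter_upwards [eventually_birkhoffAverage_lt hω (half_pos hε), eventually_ne_atTop 0]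
      with n hn hn0
    rw [birkhoffAverage_sub, Pi.sub_apply, Pi.sub_apply, birkhoffAverage_of_comp_eq ℝ
      (MeasurableSpace.comp_eq_of_measurable_invariants hhm) (by exact_mod_cast hn0)] at hn
    simp only [h, Pi.add_apply] at hn
    linarith
  obtain ⟨u, -, hu, hlim⟩ := exists_seq_strictAnti_tendsto (0 : ℝ)
  filter_upwards [ae_all_iff.2 fun k => main (u k) (hu k)] with ω hω ε hε
  obtain ⟨k, hk⟩ := (hlim.eventually_lt_const hε).exists
  filter_upwards [hω k] with n hn
  linarith

theorem ae_tendsto_birkhoffAverage (hT : MeasurePreserving T P P) {f : Ω → ℝ}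
    (hfm : Measurable f) (hf : Integrable f P) :
    ∀ᵐ ω ∂P, Tendsto (fun n => birkhoffAverage ℝ T f n ω) atTop
      (𝓝 (P[f | MeasurableSpace.invariants T] ω)) := by
  filter_upwards [ae_eventually_birkhoffAverage_lt hT hfm hf,
    ae_eventually_birkhoffAverage_lt hT hfm.neg hf.neg,
    condExp_neg f (MeasurableSpace.invariants T)] with ω hupper hlower hneg
  refine Metric.tendsto_nhds.2 fun ε hε => ?_
  filter_upwards [hupper ε hε, hlower ε hε] with n hn hn'
  rw [hneg, birkhoffAverage_neg, Pi.neg_apply, Pi.neg_apply, Pi.neg_apply] at hn'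
  rw [Real.dist_eq, abs_lt]
  constructor <;> linarith

end Birkhoff

section Support

variable {X M : Type*} [MeasurableSpace X]

/-- A separable set is Lindelöf, so the part of it outside the support is covered by countably
many null open sets. -/
theorem measure_support_eq_one_of_isSeparable [PseudoMetricSpace M] [MeasurableSpace M]
    [OpensMeasurableSpace M] {μ : Measure M} [IsProbabilityMeasure μ] {S : Set M}
    (hS : TopologicalSpace.IsSeparable S) (hμS : ∀ᵐ x ∂μ, x ∈ S) : μ μ.support = 1 := by
  have hsep : TopologicalSpace.IsSeparable (S ∩ μ.supportᶜ) := hS.mono Set.inter_subset_left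
  have := hsep.secondCountableTopology
  have hLindelof : IsLindelof (S ∩ μ.supportᶜ) := isLindelof_iff_lindelofSpace.2 inferInstance
  have hnull : (S ∩ μ.supportᶜ)ᶜ ∈ ae μ := by
    refine hLindelof.compl_mem_sets_of_nhdsWithin fun x hx => ?_
    obtain ⟨U, hU, hU0⟩ := Measure.notMem_support_iff_exists.1 hx.2
    exact ⟨U, mem_nhdsWithin_of_mem_nhds hU, compl_mem_ae_iff.2 hU0⟩
  have hsupp : ∀ᵐ x ∂μ, x ∈ μ.support := by
    filter_upwards [hμS, hnull] with x hxS hx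
    by_contra hxsupp
    exact hx ⟨hxS, hxsupp⟩
  rwa [← prob_compl_eq_zero_iff Measure.isClosed_support.measurableSet]

theorem measure_support_map_eq_one [PseudoMetricSpace M] [MeasurableSpace M] [BorelSpace M]
    {ν : Measure X} [IsProbabilityMeasure ν] {f : X → M} (hf : AEStronglyMeasurable f ν) :
    ν.map f (ν.map f).support = 1 := by
  have := Measure.isProbabilityMeasure_map hf.aemeasurable
  obtain ⟨S, hS, hfS⟩ := hf.isSeparable_ae_range
  refine measure_support_eq_one_of_isSeparable hS.closure ?_
  have hclosed : MeasurableSet {x | x ∈ closure S} := isClosed_closure.measurableSet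
  rw [ae_map_iff hf.aemeasurable hclosed]
  exact hfS.mono fun _ hx => subset_closure hx

theorem map_mem_Pp [MetricSpace M] [MeasurableSpace M] [BorelSpace M] {p : ℝ} {ν : Measure X}
    [IsProbabilityMeasure ν] {f : X → M} (hf : AEStronglyMeasurable f ν) {x : M}
    (hx : ∫⁻ a, edist x (f a) ^ p ∂ν < ∞) : ν.map f ∈ Pp M p := by
  refine ⟨Measure.isProbabilityMeasure_map hf.aemeasurable, measure_support_map_eq_one hf, x, ?_⟩
  rwa [lintegral_map' (by fun_prop) hf.aemeasurable]

end Support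

section Contraction

variable {X M : Type*} [MeasurableSpace X] [MetricSpace M] [MeasurableSpace M] [BorelSpace M]
  {p : ℝ} {hp : 1 ≤ p} {β : Pp M p → M}

theorem map_prodMk_mem_couplings {ν : Measure X} [IsProbabilityMeasure ν] {f g : X → M}
    (hf : AEStronglyMeasurable f ν) (hg : AEStronglyMeasurable g ν) :
    letI : MeasurableSpace (M × M) := borel (M × M)
    ν.map (fun a => (f a, g a)) ∈ couplings (ν.map f) (ν.map g) := by
  let _ : MeasurableSpace (M × M) := borel (M × M)
  have : BorelSpace (M × M) := ⟨rfl⟩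
  have hfg : AEStronglyMeasurable (fun a => (f a, g a)) ν := hf.prodMk hg
  refine ⟨Measure.isProbabilityMeasure_map hfg.aemeasurable, measure_support_map_eq_one hfg,
    fun B hB => ⟨?_, ?_⟩⟩
  · have hB' : MeasurableSet (B ×ˢ (Set.univ : Set M)) := by
      rw [Set.prod_univ]; exact continuous_fst.measurable hB
    rw [Measure.map_apply_of_aemeasurable hfg.aemeasurable hB',
      Measure.map_apply_of_aemeasurable hf.aemeasurable hB, Set.mk_preimage_prod]
    simp
  · have hB' : MeasurableSet ((Set.univ : Set M) ×ˢ B) := by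
      rw [Set.univ_prod]; exact continuous_snd.measurable hB
    rw [Measure.map_apply_of_aemeasurable hfg.aemeasurable hB',
      Measure.map_apply_of_aemeasurable hg.aemeasurable hB, Set.mk_preimage_prod]
    simp

theorem wasserstein_map_le (hp : 0 ≤ p) {ν : Measure X} [IsProbabilityMeasure ν] {f g : X → M}
    (hf : AEStronglyMeasurable f ν) (hg : AEStronglyMeasurable g ν) :
    wasserstein p (ν.map f) (ν.map g) ≤ distLp p ν f g := by
  let _ : MeasurableSpace (M × M) := borel (M × M)
  have : BorelSpace (M × M) := ⟨rfl⟩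
  have hcost : Measurable fun z : M × M => edist z.1 z.2 ^ p :=
    continuous_edist.measurable.pow_const p
  refine ENNReal.rpow_le_rpow ((iInf₂_le _ (map_prodMk_mem_couplings hf hg)).trans_eq ?_)
    (by positivity)
  exact lintegral_map' hcost.aemeasurable (hf.prodMk hg).aemeasurable

theorem IsContractiveBarycentric.edist_map_le_distLp (hβ : IsContractiveBarycentric hp β)
    {ν : Measure X} [IsProbabilityMeasure ν] {f g : X → M} (hf : AEStronglyMeasurable f ν)
    (hg : AEStronglyMeasurable g ν) (hfP : ν.map f ∈ Pp M p) (hgP : ν.map g ∈ Pp M p) :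
    edist (β ⟨ν.map f, hfP⟩) (β ⟨ν.map g, hgP⟩) ≤ distLp p ν f g :=
  (hβ.contractive _ _).trans (wasserstein_map_le (by positivity) hf hg)

end Contraction

section FiniteSupport

variable {X M : Type*} [MeasurableSpace X] [MetricSpace M] {p : ℝ}

/-- The coupling that keeps the common part `c • μ` on the diagonal and moves the rest of `μ`
independently to the rest of `μ'`. -/
def partialDiagonalCoupling (c : ℝ≥0∞) (μ μ' : Measure X) : Measure (X × X) :=
  c • μ.map (fun a => (a, a)) + μ.prod (μ' - c • μ)

variable {c : ℝ≥0∞} {μ μ' : Measure X} [IsProbabilityMeasure μ] [IsProbabilityMeasure μ']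

theorem le_one_of_smul_le (h : c • μ ≤ μ') : c ≤ 1 := by
  simpa using h Set.univ

theorem sub_smul_univ (h : c • μ ≤ μ') : (μ' - c • μ) Set.univ = 1 - c := by
  have := μ.smul_finite (ne_top_of_le_ne_top ENNReal.one_ne_top (le_one_of_smul_le h))
  rw [Measure.sub_apply .univ h]
  simp

theorem map_fst_partialDiagonalCoupling (h : c • μ ≤ μ') :
    (partialDiagonalCoupling c μ μ').map Prod.fst = μ := by
  rw [partialDiagonalCoupling, Measure.map_add _ _ measurable_fst, Measure.map_smul,
    Measure.map_map measurable_fst (by fun_prop), Measure.map_fst_prod, sub_smul_univ h]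
  change c • μ.map id + _ = μ
  rw [Measure.map_id, ← add_smul, add_tsub_cancel_of_le (le_one_of_smul_le h), one_smul]

theorem map_snd_partialDiagonalCoupling (h : c • μ ≤ μ') :
    (partialDiagonalCoupling c μ μ').map Prod.snd = μ' := by
  have := μ.smul_finite (ne_top_of_le_ne_top ENNReal.one_ne_top (le_one_of_smul_le h))
  rw [partialDiagonalCoupling, Measure.map_add _ _ measurable_snd, Measure.map_smul,
    Measure.map_map measurable_snd (by fun_prop), Measure.map_snd_prod, measure_univ, one_smul]
  change c • μ.map id + _ = μ'
  rw [Measure.map_id, add_comm, Measure.sub_add_cancel_of_le h]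

theorem distLp_partialDiagonalCoupling_le (hp : 0 < p) (h : c • μ ≤ μ') {f : X → M}
    (hf : StronglyMeasurable f) {D : ℝ≥0∞} (hD : ∀ a b, edist (f a) (f b) ≤ D) :
    distLp p (partialDiagonalCoupling c μ μ') (fun z => f z.1) (fun z => f z.2)
      ≤ D * (1 - c) ^ (1 / p) := by
  have hcost : Measurable fun z : X × X => edist (f z.1) (f z.2) ^ p :=
    ((hf.comp_measurable measurable_fst).edist (hf.comp_measurable measurable_snd)).measurable
      |>.pow_const p
  have hbound : ∫⁻ z, edist (f z.1) (f z.2) ^ p ∂partialDiagonalCoupling c μ μ'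
      ≤ D ^ p * (1 - c) := by
    rw [partialDiagonalCoupling, lintegral_add_measure, lintegral_smul_measure,
      lintegral_map hcost (by fun_prop)]
    simp only [edist_self, ENNReal.zero_rpow_of_pos hp, lintegral_zero, smul_zero, zero_add]
    calc ∫⁻ z, edist (f z.1) (f z.2) ^ p ∂μ.prod (μ' - c • μ)
        ≤ ∫⁻ _, D ^ p ∂μ.prod (μ' - c • μ) := by gcongr with z; exact hD _ _
      _ = D ^ p * (1 - c) := by
          rw [lintegral_const, ← Set.univ_prod_univ, Measure.prod_prod, sub_smul_univ h,
            measure_univ, one_mul]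
  calc (∫⁻ z, edist (f z.1) (f z.2) ^ p ∂partialDiagonalCoupling c μ μ') ^ (1 / p)
      ≤ (D ^ p * (1 - c)) ^ (1 / p) := ENNReal.rpow_le_rpow hbound (by positivity)
    _ = D * (1 - c) ^ (1 / p) := by
        rw [ENNReal.mul_rpow_of_nonneg _ _ (by positivity), one_div, ENNReal.rpow_rpow_inv hp.ne']

variable [MeasurableSpace M] [BorelSpace M] {hp : 1 ≤ p} {β : Pp M p → M}

theorem IsContractiveBarycentric.edist_map_le_of_smul_le (hβ : IsContractiveBarycentric hp β)
    (h : c • μ ≤ μ') {f : X → M} (hf : StronglyMeasurable f) (hμ : μ.map f ∈ Pp M p)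
    (hμ' : μ'.map f ∈ Pp M p) {D : ℝ≥0∞} (hD : ∀ a b, edist (f a) (f b) ≤ D) :
    edist (β ⟨μ.map f, hμ⟩) (β ⟨μ'.map f, hμ'⟩) ≤ D * (1 - c) ^ (1 / p) := by
  set ν := partialDiagonalCoupling c μ μ'
  have hfst : ν.map Prod.fst = μ := map_fst_partialDiagonalCoupling h
  have hsnd : ν.map Prod.snd = μ' := map_snd_partialDiagonalCoupling h
  have : IsProbabilityMeasure (ν.map Prod.fst) := by rwa [hfst]
  have : IsProbabilityMeasure ν := Measure.isProbabilityMeasure_of_map Prod.fst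
  have hf1 : StronglyMeasurable fun z : X × X => f z.1 := hf.comp_measurable measurable_fst
  have hf2 : StronglyMeasurable fun z : X × X => f z.2 := hf.comp_measurable measurable_snd
  have hmap1 : ν.map (fun z => f z.1) = μ.map f := by
    rw [← hfst, Measure.map_map hf.measurable measurable_fst]; rfl
  have hmap2 : ν.map (fun z => f z.2) = μ'.map f := by
    rw [← hsnd, Measure.map_map hf.measurable measurable_snd]; rfl
  have hcontr := hβ.edist_map_le_distLp hf1.aestronglyMeasurable hf2.aestronglyMeasurable
    (hmap1 ▸ hμ) (hmap2 ▸ hμ')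
  simp only [hmap1, hmap2] at hcontr
  exact hcontr.trans (distLp_partialDiagonalCoupling_le (by positivity) h hf hD)

end FiniteSupport

section Finite

variable {ι M : Type*} [Fintype ι]

theorem eventually_mul_le_stdSimplex (w : stdSimplex ℝ≥0∞ ι) {c : ℝ≥0∞} (hc : c < 1) :
    ∀ᶠ w' in 𝓝 w, ∀ a, c * w a ≤ w' a := by
  refine eventually_all.2 fun a => ?_
  have hcont : Tendsto (fun w' : stdSimplex ℝ≥0∞ ι => w' a) (𝓝 w) (𝓝 (w a)) :=
    ((continuous_apply a).comp continuous_subtype_val).continuousAt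
  rcases eq_or_ne (w a) 0 with hw | hw
  · simp [hw]
  · have hwtop : w a ≠ ∞ := ne_top_of_le_ne_top ENNReal.one_ne_top (stdSimplex.le_one w a)
    have hlt : c * w a < w a := by
      simpa using ENNReal.mul_lt_mul_left hw hwtop hc
    exact (hcont.eventually_const_lt hlt).mono fun _ h => h.le

variable [MeasurableSpace ι]

/-- The probability measure on a finite type whose atoms have the weights `w`. -/
def weightedMeasure (w : stdSimplex ℝ≥0∞ ι) : Measure ι :=
  ∑ a, w a • Measure.dirac a

instance isProbabilityMeasure_weightedMeasure (w : stdSimplex ℝ≥0∞ ι) :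
    IsProbabilityMeasure (weightedMeasure w) :=
  ⟨by simp [weightedMeasure, Measure.finsetSum_apply]⟩

theorem weightedMeasure_singleton [MeasurableSingletonClass ι] (w : stdSimplex ℝ≥0∞ ι) (a : ι) :
    weightedMeasure w {a} = w a := by
  classical
  simp [weightedMeasure, Measure.finsetSum_apply, Pi.single_apply, Set.indicator_singleton]

theorem smul_weightedMeasure_le {c : ℝ≥0∞} {w w' : stdSimplex ℝ≥0∞ ι} (h : ∀ a, c * w a ≤ w' a) :
    c • weightedMeasure w ≤ weightedMeasure w' := by
  rw [weightedMeasure, Finset.smul_sum]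
  refine Finset.sum_le_sum fun a _ => ?_
  rw [smul_smul]
  exact fun s => by simpa using mul_le_mul_left (h a) (Measure.dirac a s)

variable [MeasurableSingletonClass ι] [MetricSpace M] [MeasurableSpace M] [BorelSpace M]
  {p : ℝ} {hp : 1 ≤ p} {β : Pp M p → M}

theorem map_weightedMeasure_mem_Pp (hp : 0 ≤ p) (f : ι → M) (w : stdSimplex ℝ≥0∞ ι) :
    (weightedMeasure w).map f ∈ Pp M p := by
  obtain ⟨a⟩ := nonempty_of_isProbabilityMeasure (weightedMeasure w)
  refine map_mem_Pp StronglyMeasurable.of_discrete.aestronglyMeasurable (x := f a) ?_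
  simp only [lintegral_fintype]
  exact ENNReal.sum_lt_top.2 fun b _ => ENNReal.mul_lt_top
    (ENNReal.rpow_lt_top_of_nonneg hp (edist_ne_top _ _)) (measure_lt_top _ _)

theorem IsContractiveBarycentric.continuous_map_weightedMeasure
    (hβ : IsContractiveBarycentric hp β) (f : ι → M) :
    Continuous fun w : stdSimplex ℝ≥0∞ ι =>
      β ⟨(weightedMeasure w).map f, map_weightedMeasure_mem_Pp (by positivity) f w⟩ := by
  have hp0 : 0 < p⁻¹ := by positivity
  have hD : Metric.ediam (Set.range f) ≠ ∞ :=
    Metric.isBounded_iff_ediam_ne_top.1 (Set.finite_range f).isBounded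
  have hlim : Tendsto (fun c => Metric.ediam (Set.range f) * (1 - c) ^ (1 / p)) (𝓝[<] 1)
      (𝓝 0) := by
    have hsub : Tendsto (fun c : ℝ≥0∞ => 1 - c) (𝓝[<] 1) (𝓝 (1 - 1)) :=
      (ENNReal.continuous_sub_left ENNReal.one_ne_top).continuousWithinAt
    simpa [ENNReal.zero_rpow_of_pos, hp0] using
      ENNReal.Tendsto.const_mul (hsub.ennrpow_const (1 / p)) (.inr hD)
  refine continuous_iff_continuousAt.2 fun w => EMetric.tendsto_nhds.2 fun ε hε => ?_
  obtain ⟨c, hcε, hc⟩ := ((hlim.eventually_lt_const hε).and self_mem_nhdsWithin).exists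
  filter_upwards [eventually_mul_le_stdSimplex w hc] with w' hw'
  rw [edist_comm]
  exact (hβ.edist_map_le_of_smul_le (smul_weightedMeasure_le hw') .of_discrete _ _ fun a b =>
    Metric.edist_le_ediam_of_mem (Set.mem_range_self a) (Set.mem_range_self b)).trans_lt hcε

end Finite

theorem betaCondExp_of_mem {Ω M : Type*} [MeasurableSpace Ω] [MetricSpace M] [MeasurableSpace M]
    {p : ℝ} {β : Pp M p → M} {κ : Ω → Measure Ω} {φ : Ω → M} {ω : Ω}
    (h : (κ ω).map φ ∈ Pp M p) : betaCondExp β κ φ ω = β ⟨(κ ω).map φ, h⟩ :=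
  dif_pos h

section SimpleFunc

variable {Ω X M : Type*} [MeasurableSpace Ω] [MeasurableSpace X] [MetricSpace M]
  [MeasurableSpace M] [BorelSpace M] {p : ℝ} {hp : 1 ≤ p} {β : Pp M p → M}

/-- The masses `ν (ψ = x)` of the values `x` of a simple function `ψ`, as a point of the standard
simplex. -/
def fiberWeights (ψ : SimpleFunc X M) (ν : Measure X) [IsProbabilityMeasure ν] :
    stdSimplex ℝ≥0∞ ψ.range :=
  ⟨fun x => ν (ψ ⁻¹' {x.1}), fun _ => zero_le, by
    rw [Finset.sum_coe_sort ψ.range fun x => ν (ψ ⁻¹' {x}),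
      ψ.sum_range_measure_preimage_singleton, measure_univ]⟩

theorem map_val_weightedMeasure_fiberWeights (ψ : SimpleFunc X M) (ν : Measure X)
    [IsProbabilityMeasure ν] :
    (weightedMeasure (fiberWeights ψ ν)).map Subtype.val = ν.map ψ := by
  let q : X → ψ.range := fun a => ⟨ψ a, ψ.mem_range_self a⟩
  have hq : Measurable q := ψ.measurable.subtype_mk
  have hweights : weightedMeasure (fiberWeights ψ ν) = ν.map q := by
    refine Measure.ext_of_singleton fun x => ?_
    have hfiber : q ⁻¹' {x} = ψ ⁻¹' {x.1} := by ext b; simp [q, Subtype.ext_iff]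
    rw [Measure.map_apply hq (measurableSet_singleton x), hfiber, weightedMeasure_singleton]
    rfl
  rw [hweights, Measure.map_map measurable_subtype_coe hq]
  rfl

theorem map_simpleFunc_mem_Pp (hp : 0 ≤ p) (ψ : SimpleFunc X M) (ν : Measure X)
    [IsProbabilityMeasure ν] : ν.map ψ ∈ Pp M p :=
  map_val_weightedMeasure_fiberWeights ψ ν ▸ map_weightedMeasure_mem_Pp hp _ _

theorem IsContractiveBarycentric.exists_continuous_betaCondExp_simpleFunc
    (hβ : IsContractiveBarycentric hp β) (ψ : SimpleFunc Ω M) :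
    ∃ F : stdSimplex ℝ≥0∞ ψ.range → M, Continuous F ∧
      ∀ (κ : Kernel Ω Ω) [IsMarkovKernel κ] (ω : Ω),
        betaCondExp β κ ψ ω = F (fiberWeights ψ (κ ω)) := by
  refine ⟨_, hβ.continuous_map_weightedMeasure Subtype.val, fun κ _ ω => ?_⟩
  simp only [map_val_weightedMeasure_fiberWeights]
  exact betaCondExp_of_mem _

theorem IsContractiveBarycentric.stronglyMeasurable_betaCondExp_simpleFunc
    (hβ : IsContractiveBarycentric hp β) (κ : Kernel Ω Ω) [IsMarkovKernel κ]
    (ψ : SimpleFunc Ω M) : StronglyMeasurable (betaCondExp β κ ψ) := by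
  obtain ⟨F, hF, hFκ⟩ := hβ.exists_continuous_betaCondExp_simpleFunc ψ
  have hweights : Measurable fun ω => fiberWeights ψ (κ ω) :=
    (measurable_pi_lambda _ fun x : ψ.range =>
      κ.measurable_coe (ψ.measurableSet_fiber x)).subtype_mk
  rw [show betaCondExp β κ ψ = fun ω => F (fiberWeights ψ (κ ω)) from funext (hFκ κ)]
  exact hF.comp_stronglyMeasurable hweights.stronglyMeasurable

theorem IsContractiveBarycentric.tendsto_betaCondExp_simpleFunc
    (hβ : IsContractiveBarycentric hp β) {η : ℕ → Kernel Ω Ω} [∀ n, IsMarkovKernel (η n)]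
    {κ : Kernel Ω Ω} [IsMarkovKernel κ] {ψ : SimpleFunc Ω M} {ω : Ω}
    (h : ∀ x ∈ ψ.range, Tendsto (fun n => η n ω (ψ ⁻¹' {x})) atTop (𝓝 (κ ω (ψ ⁻¹' {x})))) :
    Tendsto (fun n => betaCondExp β (η n) ψ ω) atTop (𝓝 (betaCondExp β κ ψ ω)) := by
  obtain ⟨F, hF, hFκ⟩ := hβ.exists_continuous_betaCondExp_simpleFunc ψ
  simp only [hFκ]
  refine (hF.tendsto _).comp (tendsto_subtype_rng.2 (tendsto_pi_nhds.2 fun x => ?_))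
  exact h x.1 x.2

theorem IsContractiveBarycentric.edist_betaCondExp_simpleFunc_le
    (hβ : IsContractiveBarycentric hp β) (κ κ' : Kernel Ω Ω) [IsMarkovKernel κ]
    [IsMarkovKernel κ'] (ψ : SimpleFunc Ω M) (ω : Ω) :
    edist (betaCondExp β κ ψ ω) (betaCondExp β κ' ψ ω) ≤ Metric.ediam (Set.range ψ) := by
  rw [betaCondExp_of_mem (map_simpleFunc_mem_Pp (by positivity) ψ (κ ω)),
    betaCondExp_of_mem (map_simpleFunc_mem_Pp (by positivity) ψ (κ' ω))]
  have hle : (0 : ℝ≥0∞) • κ ω ≤ κ' ω := by simp [Measure.zero_le]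
  simpa using hβ.edist_map_le_of_smul_le hle ψ.stronglyMeasurable _ _ fun a b =>
    Metric.edist_le_ediam_of_mem (Set.mem_range_self a) (Set.mem_range_self b)

end SimpleFunc

section DistLp

variable {X M : Type*} [MeasurableSpace X] [MetricSpace M] {p : ℝ} {ν : Measure X}

theorem distLp_comm (f g : X → M) : distLp p ν f g = distLp p ν g f := by
  simp only [distLp, edist_comm]

theorem distLp_congr_ae {f f' g g' : X → M} (hf : f =ᵐ[ν] f') (hg : g =ᵐ[ν] g') :
    distLp p ν f g = distLp p ν f' g' := by
  rw [distLp, distLp]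
  congr 1
  refine lintegral_congr_ae ?_
  filter_upwards [hf, hg] with ω hfω hgω
  rw [hfω, hgω]

theorem distLp_triangle (hp : 1 ≤ p) {f g h : X → M} (hf : AEStronglyMeasurable f ν)
    (hg : AEStronglyMeasurable g ν) (hh : AEStronglyMeasurable h ν) :
    distLp p ν f h ≤ distLp p ν f g + distLp p ν g h :=
  calc distLp p ν f h
      ≤ (∫⁻ a, (edist (f a) (g a) + edist (g a) (h a)) ^ p ∂ν) ^ (1 / p) := by
        rw [distLp]
        gcongr
        exact edist_triangle _ _ _
    _ ≤ distLp p ν f g + distLp p ν g h :=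
        ENNReal.lintegral_Lp_add_le (hf.edist hg) (hg.edist hh) hp

theorem distLp_triangle4 (hp : 1 ≤ p) {f g h k : X → M} (hf : AEStronglyMeasurable f ν)
    (hg : AEStronglyMeasurable g ν) (hh : AEStronglyMeasurable h ν)
    (hk : AEStronglyMeasurable k ν) :
    distLp p ν f k ≤ distLp p ν f g + distLp p ν g h + distLp p ν h k :=
  (distLp_triangle hp hf hh hk).trans (by gcongr; exact distLp_triangle hp hf hg hh)

theorem tendsto_distLp_of_dominated (hp : 0 < p) {f : X → M} {g : ℕ → X → M}
    (hf : AEStronglyMeasurable f ν) (hg : ∀ k, AEStronglyMeasurable (g k) ν) (B : X → ℝ≥0∞)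
    (hB : ∫⁻ a, B a ^ p ∂ν ≠ ∞) (hbound : ∀ k, ∀ᵐ a ∂ν, edist (f a) (g k a) ≤ B a)
    (hlim : ∀ᵐ a ∂ν, Tendsto (fun k => g k a) atTop (𝓝 (f a))) :
    Tendsto (fun k => distLp p ν f (g k)) atTop (𝓝 0) := by
  have hcost : Tendsto (fun k => ∫⁻ a, edist (f a) (g k a) ^ p ∂ν) atTop (𝓝 (∫⁻ _, 0 ∂ν)) := by
    refine tendsto_lintegral_of_dominated_convergence' (fun a => B a ^ p)
      (fun k => (hf.edist (hg k)).pow_const p) (fun k => ?_) hB ?_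
    · exact (hbound k).mono fun a ha => ENNReal.rpow_le_rpow ha hp.le
    · filter_upwards [hlim] with a ha
      simpa [ENNReal.zero_rpow_of_pos hp] using
        ((tendsto_const_nhds (x := f a)).edist ha).ennrpow_const p
  simpa [distLp, ENNReal.zero_rpow_of_pos (inv_pos.2 hp)] using hcost.ennrpow_const (1 / p)

variable [MeasurableSpace M] [BorelSpace M]

theorem exists_bochnerLp_ae_eq {f : X → M} (hf : AEStronglyMeasurable f ν) {x : M}
    (hx : ∫⁻ a, edist x (f a) ^ p ∂ν < ∞) : ∃ φ : BochnerLp M p ν, φ.1 =ᵐ[ν] f := by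
  refine ⟨⟨hf.mk f, hf.stronglyMeasurable_mk.measurable,
    hf.stronglyMeasurable_mk.aestronglyMeasurable, x, ?_⟩, hf.ae_eq_mk.symm⟩
  have hcongr : ∫⁻ a, edist x (f a) ^ p ∂ν = ∫⁻ a, edist x (hf.mk f a) ^ p ∂ν :=
    lintegral_congr_ae (hf.ae_eq_mk.mono fun a ha => by simp only [ha])
  rwa [← hcongr]

theorem exists_simpleFunc_tendsto_of_edist_le {f : X → M} (hf : AEStronglyMeasurable f ν) (x : M) :
    ∃ ψ : ℕ → SimpleFunc X M, (∀ᵐ a ∂ν, Tendsto (fun k => ψ k a) atTop (𝓝 (f a))) ∧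
      ∀ᵐ a ∂ν, ∀ k, edist (f a) (ψ k a) ≤ edist x (f a) := by
  have hmk : StronglyMeasurable (hf.mk f) := hf.stronglyMeasurable_mk
  let S : Set M := Set.range (hf.mk f) ∪ {x}
  have hS : TopologicalSpace.SeparableSpace S :=
    (hmk.isSeparable_range.union (Set.finite_singleton x).isSeparable).separableSpace
  have hx : x ∈ S := .inr rfl
  have hfS : ∀ a, hf.mk f a ∈ S := fun a => .inl (Set.mem_range_self a)
  refine ⟨SimpleFunc.approxOn (hf.mk f) hmk.measurable S x hx, ?_, ?_⟩
  · filter_upwards [hf.ae_eq_mk] with a ha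
    rw [ha]
    exact SimpleFunc.tendsto_approxOn hmk.measurable hx (subset_closure (hfS a))
  · filter_upwards [hf.ae_eq_mk] with a ha k
    rw [ha, edist_comm]
    exact SimpleFunc.edist_approxOn_le hmk.measurable hx a k

end DistLp

section InvariantKernel

variable {Ω M : Type*} [MeasurableSpace Ω] {P : Measure Ω} {η : Kernel Ω Ω}

theorem lintegral_lintegral_of_invariant (hη : η.Invariant P) {f : Ω → ℝ≥0∞}
    (hf : AEMeasurable f P) : ∫⁻ ω, ∫⁻ a, f a ∂η ω ∂P = ∫⁻ a, f a ∂P := by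
  rw [← Measure.lintegral_bind η.aemeasurable (by rwa [hη.def]), hη.def]

theorem ae_ae_of_invariant (hη : η.Invariant P) {q : Ω → Prop} (h : ∀ᵐ a ∂P, q a) :
    ∀ᵐ ω ∂P, ∀ᵐ a ∂η ω, q a :=
  Measure.ae_ae_of_ae_comp (by rwa [hη.def])

theorem ae_lintegral_lt_top_of_invariant (hη : η.Invariant P) {f : Ω → ℝ≥0∞}
    (hf : AEMeasurable f P) (hfint : ∫⁻ a, f a ∂P ≠ ∞) : ∀ᵐ ω ∂P, ∫⁻ a, f a ∂η ω < ∞ := by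
  have hmeas : AEMeasurable (fun ω => ∫⁻ a, f a ∂η ω) P :=
    ⟨_, hf.measurable_mk.lintegral_kernel,
      (ae_ae_of_invariant hη hf.ae_eq_mk).mono fun _ h => lintegral_congr_ae h⟩
  refine ae_lt_top' hmeas ?_
  rwa [lintegral_lintegral_of_invariant hη hf]

theorem ae_aestronglyMeasurable_of_invariant [TopologicalSpace M] (hη : η.Invariant P) {f : Ω → M}
    (hf : AEStronglyMeasurable f P) : ∀ᵐ ω ∂P, AEStronglyMeasurable f (η ω) :=
  (ae_ae_of_invariant hη hf.ae_eq_mk).mono fun _ h => ⟨hf.mk f, hf.stronglyMeasurable_mk, h⟩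

variable [MetricSpace M] [MeasurableSpace M] [BorelSpace M] {p : ℝ} {hp : 1 ≤ p}
  {β : Pp M p → M} [IsMarkovKernel η]

theorem ae_map_mem_Pp_of_invariant (hη : η.Invariant P) (φ : BochnerLp M p P) :
    ∀ᵐ ω ∂P, (η ω).map φ.1 ∈ Pp M p := by
  obtain ⟨φ, -, hφ, x, hx⟩ := φ
  filter_upwards [ae_aestronglyMeasurable_of_invariant hη hφ,
    ae_lintegral_lt_top_of_invariant hη ((aestronglyMeasurable_const.edist hφ).pow_const p) hx.ne]
    with ω hφω hxω
  exact map_mem_Pp hφω hxω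

theorem exists_simpleFunc_tendsto_distLp (hp : 0 < p) (φ : BochnerLp M p P) :
    ∃ ψ : ℕ → SimpleFunc Ω M, (∀ k, distLp p P φ.1 (ψ k) ≠ ∞) ∧
      Tendsto (fun k => distLp p P φ.1 (ψ k)) atTop (𝓝 0) ∧ ∀ η : Kernel Ω Ω, η.Invariant P →
        ∀ᵐ ω ∂P, Tendsto (fun k => distLp p (η ω) φ.1 (ψ k)) atTop (𝓝 0) := by
  obtain ⟨φ, -, hφ, x, hx⟩ := φ
  obtain ⟨ψ, hlim, hbound⟩ := exists_simpleFunc_tendsto_of_edist_le hφ x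
  have hψ : ∀ (ν : Measure Ω) k, AEStronglyMeasurable (ψ k) ν :=
    fun ν k => (ψ k).aestronglyMeasurable
  refine ⟨ψ, fun k => ?_,
    tendsto_distLp_of_dominated hp hφ (hψ P) _ hx.ne (ae_all_iff.1 hbound) hlim, fun η hη => ?_⟩
  · refine ENNReal.rpow_ne_top_of_nonneg (by positivity)
      (ne_top_of_le_ne_top hx.ne (lintegral_mono_ae ?_))
    exact hbound.mono fun ω hω => ENNReal.rpow_le_rpow (hω k) hp.le
  · filter_upwards [ae_aestronglyMeasurable_of_invariant hη hφ, ae_ae_of_invariant hη hbound,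
      ae_ae_of_invariant hη hlim,
      ae_lintegral_lt_top_of_invariant hη ((aestronglyMeasurable_const.edist hφ).pow_const p) hx.ne]
      with ω hφω hboundω hlimω hxω
    exact tendsto_distLp_of_dominated hp hφω (hψ _) _ hxω.ne (ae_all_iff.1 hboundω) hlimω

theorem betaCondExp_const (hβ : IsContractiveBarycentric hp β) (x : M) (ω : Ω) :
    betaCondExp β η (fun _ => x) ω = x := by
  have hdirac : (η ω).map (fun _ => x) = Measure.dirac x := by simp
  rw [betaCondExp_of_mem (hdirac ▸ dirac_mem_Pp hp x)]
  simpa only [hdirac] using hβ.apply_dirac x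

namespace IsContractiveBarycentric

variable (hβ : IsContractiveBarycentric hp β) (hη : η.Invariant P)
include hβ hη

theorem ae_edist_betaCondExp_le {f g : Ω → M} (hf : AEStronglyMeasurable f P)
    (hg : AEStronglyMeasurable g P) (hfP : ∀ᵐ ω ∂P, (η ω).map f ∈ Pp M p)
    (hgP : ∀ᵐ ω ∂P, (η ω).map g ∈ Pp M p) :
    ∀ᵐ ω ∂P, edist (betaCondExp β η f ω) (betaCondExp β η g ω) ≤ distLp p (η ω) f g := by
  filter_upwards [ae_aestronglyMeasurable_of_invariant hη hf,
    ae_aestronglyMeasurable_of_invariant hη hg, hfP, hgP] with ω hfω hgω hfPω hgPω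
  rw [betaCondExp_of_mem hfPω, betaCondExp_of_mem hgPω]
  exact hβ.edist_map_le_distLp hfω hgω hfPω hgPω

theorem distLp_betaCondExp_le {f g : Ω → M} (hf : AEStronglyMeasurable f P)
    (hg : AEStronglyMeasurable g P) (hfP : ∀ᵐ ω ∂P, (η ω).map f ∈ Pp M p)
    (hgP : ∀ᵐ ω ∂P, (η ω).map g ∈ Pp M p) :
    distLp p P (betaCondExp β η f) (betaCondExp β η g) ≤ distLp p P f g := by
  have hp0 : 0 < p := zero_lt_one.trans_le hp
  refine ENNReal.rpow_le_rpow ?_ (by positivity)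
  rw [← lintegral_lintegral_of_invariant hη ((hf.edist hg).pow_const p)]
  refine lintegral_mono_ae ?_
  filter_upwards [hβ.ae_edist_betaCondExp_le hη hf hg hfP hgP] with ω hω
  rwa [distLp, one_div, ENNReal.le_rpow_inv_iff hp0] at hω

variable (φ : BochnerLp M p P) (ψ : SimpleFunc Ω M)

theorem ae_edist_betaCondExp_simpleFunc_le :
    ∀ᵐ ω ∂P, edist (betaCondExp β η φ.1 ω) (betaCondExp β η ψ ω) ≤ distLp p (η ω) φ.1 ψ :=
  hβ.ae_edist_betaCondExp_le hη φ.2.2.1 ψ.aestronglyMeasurable (ae_map_mem_Pp_of_invariant hη φ)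
    (.of_forall fun _ => map_simpleFunc_mem_Pp (by positivity) ψ _)

theorem distLp_betaCondExp_simpleFunc_le :
    distLp p P (betaCondExp β η φ.1) (betaCondExp β η ψ) ≤ distLp p P φ.1 ψ :=
  hβ.distLp_betaCondExp_le hη φ.2.2.1 ψ.aestronglyMeasurable (ae_map_mem_Pp_of_invariant hη φ)
    (.of_forall fun _ => map_simpleFunc_mem_Pp (by positivity) ψ _)

theorem aestronglyMeasurable_betaCondExp :
    AEStronglyMeasurable (betaCondExp β η φ.1) P := by
  obtain ⟨ψ, -, -, hψ⟩ := exists_simpleFunc_tendsto_distLp (zero_lt_one.trans_le hp) φ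
  refine aestronglyMeasurable_of_tendsto_ae atTop
    (fun k => (hβ.stronglyMeasurable_betaCondExp_simpleFunc η (ψ k)).aestronglyMeasurable) ?_
  filter_upwards [ae_all_iff.2 fun k => hβ.ae_edist_betaCondExp_simpleFunc_le hη φ (ψ k),
    hψ η hη] with ω hω hlim
  refine tendsto_iff_edist_tendsto_0.2 (tendsto_of_tendsto_of_tendsto_of_le_of_le
    tendsto_const_nhds hlim (fun _ => zero_le) fun k => ?_)
  rw [edist_comm]
  exact hω k

theorem exists_bochnerLp_ae_eq_betaCondExp :
    ∃ γ : BochnerLp M p P, γ.1 =ᵐ[P] betaCondExp β η φ.1 := by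
  obtain ⟨x, hx⟩ := φ.2.2.2
  refine exists_bochnerLp_ae_eq (hβ.aestronglyMeasurable_betaCondExp hη φ) (x := x) ?_
  have hle : distLp p P (betaCondExp β η φ.1) (betaCondExp β η fun _ => x) ≤
      distLp p P φ.1 fun _ => x :=
    hβ.distLp_betaCondExp_simpleFunc_le hη φ (SimpleFunc.const Ω x)
  simp only [distLp, betaCondExp_const hβ, edist_comm _ x] at hle
  exact ((ENNReal.rpow_le_rpow_iff (by positivity)).1 hle).trans_lt hx

end IsContractiveBarycentric

end InvariantKernel

theorem tendsto_zero_of_le_of_tendsto {u w : ℕ → ℝ≥0∞} {v : ℕ → ℕ → ℝ≥0∞}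
    (hle : ∀ k n, u n ≤ v k n) (hv : ∀ k, Tendsto (v k) atTop (𝓝 (w k)))
    (hw : Tendsto w atTop (𝓝 0)) : Tendsto u atTop (𝓝 0) := by
  refine tendsto_order.2 ⟨fun _ h => absurd h not_lt_zero, fun ε hε => ?_⟩
  obtain ⟨k, hk⟩ := (hw.eventually_lt_const hε).exists
  exact ((hv k).eventually_lt_const hk).mono fun n => (hle k n).trans_lt

section KernelConvergence

variable {Ω M : Type*} [MeasurableSpace Ω]

/-- The kernels `η n` converge to `κ` almost everywhere when tested against any fixed nonnegative
`P`-integrable function. For the orbit kernels of a measure-preserving map this is the pointwise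
ergodic theorem. -/
def AETendstoLIntegral (P : Measure Ω) (η : ℕ → Kernel Ω Ω) (κ : Kernel Ω Ω) : Prop :=
  ∀ f : Ω → ℝ≥0∞, AEMeasurable f P → ∫⁻ a, f a ∂P ≠ ∞ →
    ∀ᵐ ω ∂P, Tendsto (fun n => ∫⁻ a, f a ∂η n ω) atTop (𝓝 (∫⁻ a, f a ∂κ ω))

variable {P : Measure Ω} {η : ℕ → Kernel Ω Ω} {κ : Kernel Ω Ω}

namespace AETendstoLIntegral

theorem ae_tendsto_measure [IsFiniteMeasure P] (h : AETendstoLIntegral P η κ) {A : Set Ω}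
    (hA : MeasurableSet A) : ∀ᵐ ω ∂P, Tendsto (fun n => η n ω A) atTop (𝓝 (κ ω A)) := by
  simpa only [lintegral_indicator_one hA] using
    h (A.indicator 1) (aemeasurable_one.indicator hA) (by simp [lintegral_indicator_one hA])

theorem ae_tendsto_distLp [MetricSpace M] {p : ℝ} (h : AETendstoLIntegral P η κ) (hp : 0 < p)
    {f g : Ω → M} (hf : AEStronglyMeasurable f P) (hg : AEStronglyMeasurable g P)
    (hfg : distLp p P f g ≠ ∞) :
    ∀ᵐ ω ∂P, Tendsto (fun n => distLp p (η n ω) f g) atTop (𝓝 (distLp p (κ ω) f g)) := by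
  have hfin : ∫⁻ a, edist (f a) (g a) ^ p ∂P ≠ ∞ := by
    rwa [distLp, Ne, ENNReal.rpow_eq_top_iff_of_pos (by positivity)] at hfg
  exact (h _ ((hf.edist hg).pow_const p) hfin).mono fun _ hω => hω.ennrpow_const (1 / p)

end AETendstoLIntegral

namespace IsContractiveBarycentric

variable [MetricSpace M] [MeasurableSpace M] [BorelSpace M] {p : ℝ} {hp : 1 ≤ p} {β : Pp M p → M}
  [IsFiniteMeasure P] [∀ n, IsMarkovKernel (η n)] [IsMarkovKernel κ]
  (hβ : IsContractiveBarycentric hp β) (h : AETendstoLIntegral P η κ)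
include hβ h

theorem ae_tendsto_betaCondExp_simpleFunc (ψ : SimpleFunc Ω M) :
    ∀ᵐ ω ∂P, Tendsto (fun n => betaCondExp β (η n) ψ ω) atTop (𝓝 (betaCondExp β κ ψ ω)) := by
  have hfibers : ∀ᵐ ω ∂P, ∀ x ∈ ψ.range,
      Tendsto (fun n => η n ω (ψ ⁻¹' {x})) atTop (𝓝 (κ ω (ψ ⁻¹' {x}))) :=
    (Finset.eventually_all _).2 fun x _ => h.ae_tendsto_measure (ψ.measurableSet_fiber x)
  exact hfibers.mono fun ω hω => hβ.tendsto_betaCondExp_simpleFunc hω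

theorem tendsto_distLp_betaCondExp_simpleFunc (ψ : SimpleFunc Ω M) :
    Tendsto (fun n => distLp p P (betaCondExp β κ ψ) (betaCondExp β (η n) ψ)) atTop (𝓝 0) := by
  have hdiam : Metric.ediam (Set.range ψ) ≠ ∞ :=
    Metric.isBounded_iff_ediam_ne_top.1 ψ.finite_range.isBounded
  refine tendsto_distLp_of_dominated (by positivity)
    (hβ.stronglyMeasurable_betaCondExp_simpleFunc κ ψ).aestronglyMeasurable
    (fun n => (hβ.stronglyMeasurable_betaCondExp_simpleFunc (η n) ψ).aestronglyMeasurable)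
    (fun _ => Metric.ediam (Set.range ψ)) ?_
    (fun n => .of_forall (hβ.edist_betaCondExp_simpleFunc_le κ (η n) ψ))
    (hβ.ae_tendsto_betaCondExp_simpleFunc h ψ)
  rw [lintegral_const]
  exact ENNReal.mul_ne_top (ENNReal.rpow_ne_top_of_nonneg (by positivity) hdiam)
    (measure_ne_top _ _)

variable (hη : ∀ n, (η n).Invariant P) (hκ : κ.Invariant P) (φ : BochnerLp M p P)
include hη hκ

theorem ae_tendsto_betaCondExp :
    ∀ᵐ ω ∂P, Tendsto (fun n => betaCondExp β (η n) φ.1 ω) atTop (𝓝 (betaCondExp β κ φ.1 ω)) := by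
  have hp0 : 0 < p := zero_lt_one.trans_le hp
  obtain ⟨ψ, hfin, -, hψ⟩ := exists_simpleFunc_tendsto_distLp hp0 φ
  filter_upwards [hψ κ hκ,
    ae_all_iff.2 fun n => ae_all_iff.2 fun k =>
      hβ.ae_edist_betaCondExp_simpleFunc_le (hη n) φ (ψ k),
    ae_all_iff.2 fun k => hβ.ae_edist_betaCondExp_simpleFunc_le hκ φ (ψ k),
    ae_all_iff.2 fun k => hβ.ae_tendsto_betaCondExp_simpleFunc h (ψ k),
    ae_all_iff.2 fun k => h.ae_tendsto_distLp hp0 φ.2.2.1 (ψ k).aestronglyMeasurable (hfin k)]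
    with ω hψω hηω hκω hsimple hdist
  refine tendsto_iff_edist_tendsto_0.2 (tendsto_zero_of_le_of_tendsto (fun k n => ?_)
    (fun k => ((hdist k).add (tendsto_iff_edist_tendsto_0.1 (hsimple k))).add_const
      (distLp p (κ ω) φ.1 (ψ k))) (by simpa using hψω.add hψω))
  calc edist (betaCondExp β (η n) φ.1 ω) (betaCondExp β κ φ.1 ω)
      ≤ edist (betaCondExp β (η n) φ.1 ω) (betaCondExp β (η n) (ψ k) ω) +
          edist (betaCondExp β (η n) (ψ k) ω) (betaCondExp β κ (ψ k) ω) +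
          edist (betaCondExp β κ (ψ k) ω) (betaCondExp β κ φ.1 ω) := edist_triangle4 _ _ _ _
    _ ≤ distLp p (η n ω) φ.1 (ψ k) +
          edist (betaCondExp β (η n) (ψ k) ω) (betaCondExp β κ (ψ k) ω) +
          distLp p (κ ω) φ.1 (ψ k) := by
        rw [edist_comm (betaCondExp β κ (ψ k) ω) (betaCondExp β κ φ.1 ω)]
        gcongr
        exacts [hηω n k, hκω k]

theorem tendsto_distLp_betaCondExp :
    Tendsto (fun n => distLp p P (betaCondExp β (η n) φ.1) (betaCondExp β κ φ.1)) atTop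
      (𝓝 0) := by
  obtain ⟨ψ, -, hψ, -⟩ := exists_simpleFunc_tendsto_distLp (zero_lt_one.trans_le hp) φ
  have hmeas : ∀ (ξ : Kernel Ω Ω) [IsMarkovKernel ξ] k,
      AEStronglyMeasurable (betaCondExp β ξ (ψ k)) P := fun ξ _ k =>
    (hβ.stronglyMeasurable_betaCondExp_simpleFunc ξ (ψ k)).aestronglyMeasurable
  refine tendsto_zero_of_le_of_tendsto (fun k n => ?_)
    (fun k => ((hβ.tendsto_distLp_betaCondExp_simpleFunc h (ψ k)).const_add
      (distLp p P φ.1 (ψ k))).add_const (distLp p P φ.1 (ψ k))) (by simpa using hψ.add hψ)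
  calc distLp p P (betaCondExp β (η n) φ.1) (betaCondExp β κ φ.1)
      ≤ distLp p P (betaCondExp β (η n) φ.1) (betaCondExp β (η n) (ψ k)) +
          distLp p P (betaCondExp β (η n) (ψ k)) (betaCondExp β κ (ψ k)) +
          distLp p P (betaCondExp β κ (ψ k)) (betaCondExp β κ φ.1) :=
        distLp_triangle4 hp (hβ.aestronglyMeasurable_betaCondExp (hη n) φ) (hmeas _ k)
          (hmeas _ k) (hβ.aestronglyMeasurable_betaCondExp hκ φ)
    _ ≤ distLp p P φ.1 (ψ k) +
          distLp p P (betaCondExp β κ (ψ k)) (betaCondExp β (η n) (ψ k)) +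
          distLp p P φ.1 (ψ k) := by
        rw [distLp_comm (betaCondExp β (η n) (ψ k)), distLp_comm _ (betaCondExp β κ φ.1)]
        gcongr
        exacts [hβ.distLp_betaCondExp_simpleFunc_le (hη n) φ (ψ k),
          hβ.distLp_betaCondExp_simpleFunc_le hκ φ (ψ k)]

end IsContractiveBarycentric

end KernelConvergence

section Disintegration

variable {Ω : Type*} {m : MeasurableSpace Ω} [mΩ : MeasurableSpace Ω] {P : Measure Ω}
  {κ : Ω → Measure Ω}

theorem exists_isDisintegration [StandardBorelSpace Ω] [IsFiniteMeasure P] (hm : m ≤ mΩ) :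
    ∃ κ, IsDisintegration m P κ :=
  ⟨condExpKernel P m, fun _ => inferInstance, fun _ hA => measurable_condExpKernel hA,
    fun _ hA => condExpKernel_ae_eq_condExp hm hA⟩

namespace IsDisintegration

variable (hκ : IsDisintegration m P κ) (hm : m ≤ mΩ)

/-- A disintegration as a kernel for the ambient `σ`-algebra, forgetting that it is measurable
for the smaller one. -/
def kernel : Kernel Ω Ω :=
  ⟨κ, Measure.measurable_of_measurable_coe _ fun A hA => (hκ.measurable A hA).mono hm le_rfl⟩

instance isMarkovKernel_kernel : IsMarkovKernel (hκ.kernel hm) :=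
  ⟨hκ.isProbabilityMeasure⟩

@[simp]
theorem kernel_apply (ω : Ω) : hκ.kernel hm ω = κ ω := rfl

include hκ hm

theorem bind_restrict [IsFiniteMeasure P] {A : Set Ω} (hA : MeasurableSet[m] A) :
    (P.restrict A).bind (hκ.kernel hm) = P.restrict A := by
  refine Measure.ext fun s hs => ?_
  have hks : Measurable fun ω => hκ.kernel hm ω s := Kernel.measurable_coe _ hs
  rw [Measure.bind_apply hs (Kernel.aemeasurable _)]
  have hfin : ∫⁻ ω in A, hκ.kernel hm ω s ∂P ≠ ∞ := by
    refine ne_top_of_le_ne_top (measure_ne_top P A) ?_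
    calc ∫⁻ ω in A, hκ.kernel hm ω s ∂P ≤ ∫⁻ _ in A, 1 ∂P := lintegral_mono fun _ => prob_le_one
      _ = P A := setLIntegral_one A
  refine (ENNReal.toReal_eq_toReal_iff' hfin (measure_ne_top _ _)).1 ?_
  calc (∫⁻ ω in A, hκ.kernel hm ω s ∂P).toReal
      = ∫ ω in A, (hκ.kernel hm ω s).toReal ∂P :=
        (integral_toReal hks.aemeasurable (.of_forall fun _ => measure_lt_top _ _)).symm
    _ = ∫ ω in A, P[s.indicator fun _ => (1 : ℝ) | m] ω ∂P :=
        integral_congr_ae (ae_restrict_of_ae (hκ.ae_eq_condExp s hs))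
    _ = ∫ ω in A, s.indicator (fun _ => (1 : ℝ)) ω ∂P :=
        setIntegral_condExp hm ((integrable_const _).indicator hs) hA
    _ = (P.restrict A s).toReal := by rw [integral_indicator hs]; simp [Measure.real]

theorem invariant_kernel [IsFiniteMeasure P] : (hκ.kernel hm).Invariant P := by
  simpa [Kernel.Invariant] using hκ.bind_restrict hm MeasurableSet.univ

theorem setLIntegral_lintegral [IsFiniteMeasure P] {A : Set Ω} (hA : MeasurableSet[m] A)
    {f : Ω → ℝ≥0∞} (hf : Measurable f) :
    ∫⁻ ω in A, ∫⁻ a, f a ∂κ ω ∂P = ∫⁻ ω in A, f ω ∂P := by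
  conv_rhs => rw [← hκ.bind_restrict hm hA]
  exact (Measure.lintegral_bind (hκ.kernel hm).aemeasurable hf.aemeasurable).symm

theorem toReal_lintegral_ae_eq_condExp [IsFiniteMeasure P] {f : Ω → ℝ≥0∞} (hf : Measurable f)
    (hfint : ∫⁻ ω, f ω ∂P ≠ ∞) :
    (fun ω => (∫⁻ a, f a ∂κ ω).toReal) =ᵐ[P] P[fun ω => (f ω).toReal | m] := by
  have hmeas : Measurable[m] fun ω => ∫⁻ a, f a ∂κ ω :=
    (Measure.measurable_lintegral hf).comp
      (Measure.measurable_of_measurable_coe _ fun A hA => hκ.measurable A hA)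
  have hlint : ∫⁻ ω, ∫⁻ a, f a ∂κ ω ∂P ≠ ∞ := by
    simpa using (hκ.setLIntegral_lintegral hm .univ hf).trans_ne (by simpa using hfint)
  have hf_lt_top : ∀ᵐ ω ∂P, f ω < ∞ := ae_lt_top hf hfint
  have hlint_lt_top : ∀ᵐ ω ∂P, ∫⁻ a, f a ∂κ ω < ∞ := ae_lt_top (hmeas.mono hm le_rfl) hlint
  refine ae_eq_condExp_of_forall_setIntegral_eq hm
    (integrable_toReal_of_lintegral_ne_top hf.aemeasurable hfint)
    (fun _ _ _ => (integrable_toReal_of_lintegral_ne_top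
      (hmeas.mono hm le_rfl).aemeasurable hlint).integrableOn)
    (fun A hA _ => ?_) hmeas.ennreal_toReal.stronglyMeasurable.aestronglyMeasurable
  rw [integral_toReal (hmeas.mono hm le_rfl).aemeasurable (ae_restrict_of_ae hlint_lt_top),
    integral_toReal hf.aemeasurable (ae_restrict_of_ae hf_lt_top),
    hκ.setLIntegral_lintegral hm hA hf]

end IsDisintegration

end Disintegration

section Orbit

variable {Ω : Type*} [MeasurableSpace Ω] {T : Ω → Ω} {P : Measure Ω}

theorem lintegral_empiricalMeasure_id (n : ℕ) (ω : Ω) {f : Ω → ℝ≥0∞} (hf : Measurable f) :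
    ∫⁻ a, f a ∂empiricalMeasure T id n ω
      = (n : ℝ≥0∞)⁻¹ * ∑ k ∈ Finset.range n, f (T^[k] ω) := by
  rw [empiricalMeasure, lintegral_smul_measure, lintegral_finsetSum_measure, smul_eq_mul]
  simp only [lintegral_dirac' _ hf, id]

/-- The Markov kernel `ω ↦ (1/(n+1)) ∑_{k ≤ n} δ_{T^k ω}`, with the same shift of the index as in
`baryEmpirical`. -/
def orbitKernel (hT : Measurable T) (n : ℕ) : Kernel Ω Ω :=
  ⟨empiricalMeasure T id (n + 1), Measure.measurable_of_measurable_coe _ fun A hA => by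
    simp only [← lintegral_indicator_one hA,
      lintegral_empiricalMeasure_id _ _ (measurable_one.indicator hA)]
    exact (Finset.measurable_sum _ fun k _ =>
      (measurable_one.indicator hA).comp (hT.iterate k)).const_mul _⟩

theorem lintegral_orbitKernel (hT : Measurable T) (n : ℕ) (ω : Ω) {f : Ω → ℝ≥0∞}
    (hf : Measurable f) :
    ∫⁻ a, f a ∂orbitKernel hT n ω
      = ((n + 1 : ℕ) : ℝ≥0∞)⁻¹ * ∑ k ∈ Finset.range (n + 1), f (T^[k] ω) :=
  lintegral_empiricalMeasure_id _ _ hf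

instance isMarkovKernel_orbitKernel (hT : Measurable T) (n : ℕ) :
    IsMarkovKernel (orbitKernel hT n) := by
  refine ⟨fun ω => ⟨?_⟩⟩
  rw [← lintegral_one, lintegral_orbitKernel hT n ω measurable_const]
  simp only [Finset.sum_const, Finset.card_range, nsmul_eq_mul, mul_one]
  exact ENNReal.inv_mul_cancel (by simp) (ENNReal.natCast_ne_top _)

theorem invariant_orbitKernel (hT : MeasurePreserving T P P) (n : ℕ) :
    (orbitKernel hT.measurable n).Invariant P := by
  refine Measure.ext_of_lintegral _ fun f hf => ?_
  have hf_iter (k : ℕ) : Measurable fun ω => f (T^[k] ω) := hf.comp (hT.measurable.iterate k)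
  have hiter (k : ℕ) : ∫⁻ ω, f (T^[k] ω) ∂P = ∫⁻ ω, f ω ∂P := (hT.iterate k).lintegral_comp hf
  rw [Measure.lintegral_bind (orbitKernel hT.measurable n).aemeasurable hf.aemeasurable]
  simp only [lintegral_orbitKernel hT.measurable n _ hf]
  rw [lintegral_const_mul _ (Finset.measurable_sum _ fun k _ => hf_iter k),
    lintegral_finsetSum _ fun k _ => hf_iter k]
  simp only [hiter, Finset.sum_const, Finset.card_range, nsmul_eq_mul, ← mul_assoc]
  rw [ENNReal.inv_mul_cancel (by simp) (ENNReal.natCast_ne_top _), one_mul]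

theorem lintegral_coe_orbitKernel (hT : Measurable T) (n : ℕ) (ω : Ω) {g : Ω → ℝ≥0}
    (hg : Measurable g) :
    ∫⁻ a, g a ∂orbitKernel hT n ω =
      ENNReal.ofReal (birkhoffAverage ℝ T (fun a => (g a : ℝ)) (n + 1) ω) := by
  rw [lintegral_orbitKernel hT n ω hg.coe_nnreal_ennreal, birkhoffAverage, birkhoffSum, smul_eq_mul,
    ENNReal.ofReal_mul (by positivity), ENNReal.ofReal_sum_of_nonneg fun _ _ => NNReal.coe_nonneg _,
    ENNReal.ofReal_inv_of_pos (by positivity), ENNReal.ofReal_natCast]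
  simp only [ENNReal.ofReal_coe_nnreal]

theorem IsDisintegration.aetendstoLIntegral_orbitKernel [IsFiniteMeasure P] {κ : Ω → Measure Ω}
    (hκ : IsDisintegration (MeasurableSpace.invariants T) P κ) (hT : MeasurePreserving T P P) :
    AETendstoLIntegral P (orbitKernel hT.measurable)
      (hκ.kernel (MeasurableSpace.invariants_le T)) := by
  intro f hf hfint
  have hm := MeasurableSpace.invariants_le T
  obtain ⟨g, hg, hfg⟩ : ∃ g : Ω → ℝ≥0, Measurable g ∧ f =ᵐ[P] fun ω => (g ω : ℝ≥0∞) := by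
    refine ⟨fun ω => (hf.mk f ω).toNNReal, hf.measurable_mk.ennreal_toNNReal, ?_⟩
    filter_upwards [hf.ae_eq_mk, ae_lt_top' hf hfint] with ω hω hlt
    rw [ENNReal.coe_toNNReal (hω ▸ hlt.ne), hω]
  have hgE : Measurable fun ω => (g ω : ℝ≥0∞) := hg.coe_nnreal_ennreal
  have hgint : ∫⁻ ω, g ω ∂P ≠ ∞ := by rwa [← lintegral_congr_ae hfg]
  have hgR : Integrable (fun ω => (g ω : ℝ)) P :=
    integrable_toReal_of_lintegral_ne_top hgE.aemeasurable hgint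
  filter_upwards [ae_ae_of_invariant (hκ.invariant_kernel hm) hfg,
    ae_all_iff.2 fun n => ae_ae_of_invariant (invariant_orbitKernel hT n) hfg,
    ae_lintegral_lt_top_of_invariant (hκ.invariant_kernel hm) hgE.aemeasurable hgint,
    ae_tendsto_birkhoffAverage hT hg.coe_nnreal_real hgR,
    hκ.toReal_lintegral_ae_eq_condExp hm hgE hgint] with ω hκω hηω hlt hlim hcond
  rw [IsDisintegration.kernel_apply] at hlt hκω ⊢
  have hlim' := ENNReal.tendsto_ofReal (hlim.comp (tendsto_add_atTop_nat 1))
  simp only [ENNReal.coe_toReal] at hcond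
  rw [← hcond, ENNReal.ofReal_toReal hlt.ne] at hlim'
  simpa only [Function.comp_apply, lintegral_congr_ae (hηω _), lintegral_congr_ae hκω,
    lintegral_coe_orbitKernel hT.measurable _ _ hg] using hlim'

end Orbit

section ErgodicLimit

theorem empiricalMeasure_eq_dirac {Ω M : Type*} [MeasurableSpace M] {T : Ω → Ω} {φ : Ω → M}
    {ω : Ω} (h : ∀ k, φ (T^[k] ω) = φ ω) (n : ℕ) :
    empiricalMeasure T φ (n + 1) ω = Measure.dirac (φ ω) := by
  simp only [empiricalMeasure, h, Finset.sum_const, Finset.card_range]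
  rw [← Nat.cast_smul_eq_nsmul ℝ≥0∞, smul_smul,
    ENNReal.inv_mul_cancel (by simp) (ENNReal.natCast_ne_top _), one_smul]

variable {Ω M : Type*} [MeasurableSpace Ω] {T : Ω → Ω} {P : Measure Ω} {κ : Ω → Measure Ω}

theorem ae_iterate_eq_of_comp_ae_eq (hT : MeasurePreserving T P P) {φ : Ω → M}
    (h : φ ∘ T =ᵐ[P] φ) : ∀ᵐ ω ∂P, ∀ k, φ (T^[k] ω) = φ ω := by
  filter_upwards [ae_all_iff.2 fun k => (hT.iterate k).quasiMeasurePreserving.ae h] with ω hω k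
  induction k with
  | zero => rfl
  | succ k ih => rw [Function.iterate_succ_apply', ← ih]; exact hω k

theorem map_orbitKernel [MeasurableSpace M] (hT : Measurable T) (n : ℕ) (ω : Ω) {φ : Ω → M}
    (hφ : Measurable φ) : (orbitKernel hT n ω).map φ = empiricalMeasure T φ (n + 1) ω := by
  refine Measure.ext fun s hs => ?_
  rw [Measure.map_apply hφ hs]
  simp only [orbitKernel, Kernel.coe_mk, empiricalMeasure, Measure.smul_apply,
    Measure.finsetSum_apply, Measure.dirac_apply' _ (hφ hs), Measure.dirac_apply' _ hs, id]
  rfl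

theorem IsDisintegration.apply_map (hκ : IsDisintegration (MeasurableSpace.invariants T) P κ)
    (ω : Ω) : κ (T ω) = κ ω :=
  Measure.ext fun A hA =>
    congrFun (MeasurableSpace.comp_eq_of_measurable_invariants (hκ.measurable A hA)) ω

variable [MetricSpace M] [MeasurableSpace M] [BorelSpace M] {p : ℝ} {hp : 1 ≤ p} {β : Pp M p → M}

theorem betaCondExp_orbitKernel (hT : Measurable T) {φ : Ω → M} (hφ : Measurable φ) (n : ℕ) :
    betaCondExp β (orbitKernel hT n) φ = baryEmpirical hp β T φ n := by
  funext ω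
  have hmap := map_orbitKernel hT n ω hφ
  rw [betaCondExp_of_mem (hmap ▸ empiricalMeasure_mem_Pp hp T φ n ω)]
  exact congrArg β (Subtype.ext hmap)

theorem IsContractiveBarycentric.baryEmpirical_ae_eq_self (hβ : IsContractiveBarycentric hp β)
    (hT : MeasurePreserving T P P) {φ : Ω → M} (h : φ ∘ T =ᵐ[P] φ) :
    ∀ᵐ ω ∂P, ∀ n, baryEmpirical hp β T φ n ω = φ ω := by
  filter_upwards [ae_iterate_eq_of_comp_ae_eq hT h] with ω hω n
  exact (congrArg β (Subtype.ext (empiricalMeasure_eq_dirac hω n))).trans (hβ.apply_dirac _)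

namespace IsDisintegration

variable [IsFiniteMeasure P] (hκ : IsDisintegration (MeasurableSpace.invariants T) P κ)
include hκ

theorem ae_map_mem_Pp (φ : BochnerLp M p P) : ∀ᵐ ω ∂P, (κ ω).map φ.1 ∈ Pp M p :=
  ae_map_mem_Pp_of_invariant (hκ.invariant_kernel (MeasurableSpace.invariants_le T)) φ

theorem betaCondExp_comp_ae_eq (φ : BochnerLp M p P) :
    betaCondExp β κ φ.1 ∘ T =ᵐ[P] betaCondExp β κ φ.1 := by
  filter_upwards [hκ.ae_map_mem_Pp φ] with ω hω
  have hTω : (κ (T ω)).map φ.1 ∈ Pp M p := by rwa [hκ.apply_map]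
  rw [Function.comp_apply, betaCondExp_of_mem hω, betaCondExp_of_mem hTω]
  simp only [hκ.apply_map]

variable (hT : MeasurePreserving T P P) (hβ : IsContractiveBarycentric hp β)
include hT hβ

theorem ae_tendsto_baryEmpirical (φ : BochnerLp M p P) :
    ∀ᵐ ω ∂P, Tendsto (fun n => baryEmpirical hp β T φ.1 n ω) atTop
      (𝓝 (betaCondExp β κ φ.1 ω)) := by
  simp only [← betaCondExp_orbitKernel hT.measurable φ.2.1]
  exact hβ.ae_tendsto_betaCondExp (hκ.aetendstoLIntegral_orbitKernel hT)
    (invariant_orbitKernel hT) (hκ.invariant_kernel _) φ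

theorem tendsto_distLp_baryEmpirical (φ : BochnerLp M p P) :
    Tendsto (fun n => distLp p P (baryEmpirical hp β T φ.1 n) (betaCondExp β κ φ.1)) atTop
      (𝓝 0) := by
  simp only [← betaCondExp_orbitKernel hT.measurable φ.2.1]
  exact hβ.tendsto_distLp_betaCondExp (hκ.aetendstoLIntegral_orbitKernel hT)
    (invariant_orbitKernel hT) (hκ.invariant_kernel _) φ

theorem isErgodicLimitMap {Γ : BochnerLp M p P → BochnerLp M p P}
    (hΓ : ∀ φ, (Γ φ).1 =ᵐ[P] betaCondExp β κ φ.1) : IsErgodicLimitMap hp β T P Γ where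
  invariant φ := ((hT.quasiMeasurePreserving.ae_eq_comp (hΓ φ)).trans
    (hκ.betaCondExp_comp_ae_eq φ)).trans (hΓ φ).symm
  onto ψ hψ := by
    refine ⟨ψ, ?_⟩
    filter_upwards [hΓ ψ, hκ.ae_tendsto_baryEmpirical hT hβ ψ,
      hβ.baryEmpirical_ae_eq_self hT hψ] with ω hΓω hlim hconst
    simp only [hconst] at hlim
    exact hΓω.trans (tendsto_nhds_unique hlim tendsto_const_nhds)
  tendsto_ae φ := by
    filter_upwards [hΓ φ, hκ.ae_tendsto_baryEmpirical hT hβ φ] with ω hΓω hlim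
    rwa [hΓω]
  tendsto_Lp φ := by
    simpa only [distLp_congr_ae .rfl (hΓ φ)] using hκ.tendsto_distLp_baryEmpirical hT hβ φ
  contractive φ ψ := by
    rw [distLp_congr_ae (hΓ φ) (hΓ ψ)]
    exact hβ.distLp_betaCondExp_le (hκ.invariant_kernel (MeasurableSpace.invariants_le T))
      φ.2.2.1 ψ.2.2.1 (hκ.ae_map_mem_Pp φ) (hκ.ae_map_mem_Pp ψ)

theorem exists_isErgodicLimitMap : ∃ Γ, IsErgodicLimitMap hp β T P Γ := by
  choose Γ hΓ using hβ.exists_bochnerLp_ae_eq_betaCondExp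
    (hκ.invariant_kernel (MeasurableSpace.invariants_le T))
  exact ⟨Γ, hκ.isErgodicLimitMap hT hβ hΓ⟩

theorem ae_eq_betaCondExp {Γ : BochnerLp M p P → BochnerLp M p P}
    (hΓ : IsErgodicLimitMap hp β T P Γ) (φ : BochnerLp M p P) :
    (Γ φ).1 =ᵐ[P] betaCondExp β κ φ.1 := by
  filter_upwards [hΓ.tendsto_ae φ, hκ.ae_tendsto_baryEmpirical hT hβ φ] with ω hΓω hκω
  exact tendsto_nhds_unique hΓω hκω

end IsDisintegration

theorem theorem4p3_general [StandardBorelSpace Ω] [IsFiniteMeasure P]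
    (hT : MeasurePreserving T P P) (hβ : IsContractiveBarycentric hp β) :
    (∃ Γ, IsErgodicLimitMap hp β T P Γ) ∧
    (∃ κ, IsDisintegration (MeasurableSpace.invariants T) P κ) ∧
    ∀ Γ, IsErgodicLimitMap hp β T P Γ →
    ∀ κ, IsDisintegration (MeasurableSpace.invariants T) P κ →
    ∀ φ : BochnerLp M p P,
      (∀ᵐ ω ∂P, (κ ω).map φ.1 ∈ Pp M p) ∧ (Γ φ).1 =ᵐ[P] betaCondExp β κ φ.1 := by
  obtain ⟨κ, hκ⟩ := exists_isDisintegration (P := P) (MeasurableSpace.invariants_le T)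
  exact ⟨hκ.exists_isErgodicLimitMap hT hβ, ⟨κ, hκ⟩, fun Γ hΓ κ' hκ' φ =>
    ⟨hκ'.ae_map_mem_Pp φ, hκ'.ae_eq_betaCondExp hT hβ hΓ φ⟩⟩

end ErgodicLimit

end Barycentric

end

theorem theorem4p3 {Ω M : Type*} [MeasurableSpace Ω] [StandardBorelSpace Ω]
    [MetricSpace M] [CompleteSpace M] [MeasurableSpace M] [BorelSpace M]
    (P : Measure Ω) [IsProbabilityMeasure P] (T : Ω → Ω) (hT : MeasurePreserving T P P)
    (p : ℝ) (hp : 1 ≤ p) (β : Barycentric.Pp M p → M)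
    (hβ : Barycentric.IsContractiveBarycentric hp β) :
    -- the ergodic limit map exists, and so does a disintegration along the invariant sets
    (∃ Γ, Barycentric.IsErgodicLimitMap hp β T P Γ) ∧
    (∃ κ, Barycentric.IsDisintegration (MeasurableSpace.invariants T) P κ) ∧
    -- the ergodic limit is the conditional expectation, which is well defined almost everywhere
    ∀ Γ, Barycentric.IsErgodicLimitMap hp β T P Γ →
    ∀ κ, Barycentric.IsDisintegration (MeasurableSpace.invariants T) P κ →
    ∀ φ : Barycentric.BochnerLp M p P,
      (∀ᵐ ω ∂P, (κ ω).map φ.1 ∈ Barycentric.Pp M p) ∧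
      (Γ φ).1 =ᵐ[P] Barycentric.betaCondExp β κ φ.1 :=
  Barycentric.theorem4p3_general hT hβ
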